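/- **Setting.** Let $d\in\{2,3\}$, let $\Omega\subset\mathbb R^d$ be a bounded open set (for instance a bounded Lipschitz domain), let $\tau>0$, $C_0>0$ and $N\in\mathbb N$. Write $(\cdot,\cdot)$ and $\|\cdot\|$ for the inner product and norm of $L^2(\Omega)$, let $\boldsymbol n$ be the outer normal on $\partial\Omega$, let $\delta_t f^{n+1}=(f^{n+1}-f^n)/\tau$, and put $E(\phi)=\tfrac12\|\nabla\phi\|^2+C_0$. **Initial values.** $c_1^0,c_2^0\in L^2(\Omega)$; $\phi^0\in H^1(\Omega)$ with $-\Delta\phi^0=c_1^0-c_2^0$ in $\Omega$ and $\nabla\phi^0\cdot\boldsymbol n=0$ on $\partial\Omega$; $\boldsymbol u^0\in H^1(\Omega)^d$ with $\nabla\cdot\boldsymbol u^0=0$ in $\Omega$ and $\boldsymbol u^0\cdot\boldsymbol n=0$ on $\partial\Omega$; $p^0\in H^1(\Omega)$; $r^0\in\mathbb R$. **Scheme (first-order SAV pressure correction).** For $0\le n\le N-1$, the new values $c_1^{n+1},c_2^{n+1},\phi^{n+1},p^{n+1}\in H^1(\Omega)$, $\bar{\boldsymbol u}^{n+1}\in H^1_0(\Omega)^d$,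 $\boldsymbol u^{n+1}\in H^1(\Omega)^d$ and $r^{n+1}\in\mathbb R\setminus\{0\}$ satisfy $$\begin{aligned} &\delta_tc_1^{n+1}-\Delta c_1^{n+1}+\boldsymbol u^n\cdot\nabla c_1^{n+1}-\nabla\cdot(c_1^{n+1}\nabla\phi^n)=0,\\ &\delta_tc_2^{n+1}-\Delta c_2^{n+1}+\boldsymbol u^n\cdot\nabla c_2^{n+1}+\nabla\cdot(c_2^{n+1}\nabla\phi^n)=0,\\ &-\Delta\phi^{n+1}=c_1^{n+1}-c_2^{n+1},\\ &\frac{\bar{\boldsymbol u}^{n+1}-\boldsymbol u^n}{\tau}-\Delta\bar{\boldsymbol u}^{n+1}+\nabla p^n+\frac{r^{n+1}}{\sqrt{E(\phi^{n+1})}}\Big((\boldsymbol u^n\cdot\nabla)\boldsymbol u^n+(c_1^n-c_2^n)\nabla\phi^n\Big)=0,\\ &\frac{\boldsymbol u^{n+1}-\bar{\boldsymbol u}^{n+1}}{\tau}+\nabla p^{n+1}-\nabla p^n=0,\qquad \nabla\cdot\boldsymbol u^{n+1}=0,\\ &\delta_tr^{n+1}=\frac{1}{2\sqrt{E(\phi^{n+1})}}\Big(((\boldsymbol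 u^n\cdot\nabla)\boldsymbol u^n,\bar{\boldsymbol u}^{n+1})+((c_1^n-c_2^n)\nabla\phi^n,\bar{\boldsymbol u}^{n+1})\Big)\\ &\qquad\qquad-\frac{1}{2r^{n+1}}\Big(\|c_1^{n+1}-c_2^{n+1}\|^2+\int_\Omega(c_1^{n+1}+c_2^{n+1})|\nabla\phi^{n+1}|^2\,d\boldsymbol x\Big), \end{aligned}$$ with the boundary conditions, on $\partial\Omega$, $$\bar{\boldsymbol u}^{n+1}=0,\qquad \boldsymbol u^{n+1}\cdot\boldsymbol n=0,\qquad \nabla c_1^{n+1}\cdot\boldsymbol n=\nabla c_2^{n+1}\cdot\boldsymbol n=\nabla\phi^{n+1}\cdot\boldsymbol n=0 .$$ (The condition on $\boldsymbol u^{n+1}$ holds in particular if $\boldsymbol u^{n+1}=0$ on $\partial\Omega$.) The second-order equations and their boundary conditions are understood in the usual weak sense, tested with all functions of $H^1(\Omega)$ for $c_i$ and $\phi$ and with all fields of $H^1_0(\Omega)^d$ for $\bar{\boldsymbol u}$; all the integrals that occur are required to be finite. The condition $\boldsymbol v\cdot\boldsymbol n=0$ on $\partial\Omega$ means $(\boldsymbol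 v,\nabla q)+(\nabla\cdot\boldsymbol v,q)=0$ for all $q\in H^1(\Omega)$. The relation between $\boldsymbol u^{n+1}$ and $\bar{\boldsymbol u}^{n+1}$ and the equations $\nabla\cdot\boldsymbol u^n=0$ hold almost everywhere in $\Omega$. **Theorem.** Assume that $c_1^0\ge0$ and $c_2^0\ge0$ almost everywhere in $\Omega$. Then every solution of the scheme has the following properties for all $0\le n\le N-1$, with no restriction on $\tau>0$. 1. (Non-negativity) $c_1^{n+1}\ge0$ and $c_2^{n+1}\ge0$ almost everywhere in $\Omega$. 2. (Mass conservation) $\displaystyle\int_\Omega c_1^{n+1}\,d\boldsymbol x=\int_\Omega c_1^n\,d\boldsymbol x$ and $\displaystyle\int_\Omega c_2^{n+1}\,d\boldsymbol x=\int_\Omega c_2^n\,d\boldsymbol x$. 3. (Unconditional energy stability) $$E^{n+1}-E^n\le-\tau\|\nabla\bar{\boldsymbol u}^{n+1}\|^2-\tau\|c_1^{n+1}-c_2^{n+1}\|^2-\tau\Big\|\sqrt{c_1^{n+1}+c_2^{n+1}}\,\nabla\phi^{n+1}\Big\|^2,$$ where $E^n=\tfrac12\|\boldsymbol u^n\|^2+\tfrac{\tau^2}{2}\|\nabla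 p^n\|^2+|r^n|^2$. -/

import Mathlib

open MeasureTheory Filter Topology
open scoped ContDiff Gradient

namespace SAVScheme

/-- The space `ℝᵈ` with its Euclidean norm. -/
abbrev Space (d : ℕ) : Type := EuclideanSpace ℝ (Fin d)

/-- Test functions of `Ω`: smooth functions with compact support contained in `Ω`. -/
structure IsTest {d : ℕ} (Ω : Set (Space d)) (ψ : Space d → ℝ) : Prop where
  smooth : ContDiff ℝ ∞ ψ
  compact : HasCompactSupport ψ
  support : tsupport ψ ⊆ Ω

/-- `f` belongs to `L²(Ω)`. -/
def IsL2 {d : ℕ} {F : Type*} [NormedAddCommGroup F] (Ω : Set (Space d)) (f : Space d → F) : Prop :=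
  MemLp f 2 (volume.restrict Ω)

/-- `‖f‖²`, the square of the norm of `L²(Ω)`. -/
noncomputable def normSq {d : ℕ} {F : Type*} [NormedAddCommGroup F]
    (Ω : Set (Space d)) (f : Space d → F) : ℝ :=
  ∫ x in Ω, ‖f x‖ ^ 2

/-- `g ∈ L²(Ω)ᵈ` is a weak gradient of `f` in `Ω`: `∫ f ∇ψ = - ∫ ψ g` for all test functions `ψ`. -/
def IsWeakGrad {d : ℕ} (Ω : Set (Space d)) (f : Space d → ℝ) (g : Space d → Space d) : Prop :=
  IsL2 Ω g ∧ ∀ ψ : Space d → ℝ, IsTest Ω ψ → ∫ x in Ω, f x • ∇ ψ x = - ∫ x in Ω, ψ x • g x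

/-- The Sobolev space `H¹(Ω)`. -/
def IsH1 {d : ℕ} (Ω : Set (Space d)) (f : Space d → ℝ) : Prop :=
  IsL2 Ω f ∧ ∃ g : Space d → Space d, IsWeakGrad Ω f g

open Classical in
/-- The weak gradient of a function of `H¹(Ω)` (unique up to a null set). -/
noncomputable def wgrad {d : ℕ} (Ω : Set (Space d)) (f : Space d → ℝ) : Space d → Space d :=
  if h : ∃ g : Space d → Space d, IsWeakGrad Ω f g then h.choose else 0

/-- The space `H¹₀(Ω)`: the closure of the test functions in `H¹(Ω)`. -/
def IsH10 {d : ℕ} (Ω : Set (Space d)) (f : Space d → ℝ) : Prop :=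
  IsH1 Ω f ∧ ∃ ψ : ℕ → Space d → ℝ, (∀ k, IsTest Ω (ψ k)) ∧
    Tendsto (fun k => eLpNorm (fun x => ψ k x - f x) 2 (volume.restrict Ω)) atTop (𝓝 0) ∧
    Tendsto (fun k => eLpNorm (fun x => ∇ (ψ k) x - wgrad Ω f x) 2 (volume.restrict Ω))
      atTop (𝓝 0)

/-- The vector-valued space `H¹(Ω)ᵈ`. -/
def IsVecH1 {d : ℕ} (Ω : Set (Space d)) (v : Space d → Space d) : Prop :=
  ∀ i, IsH1 Ω (fun x => v x i)

/-- The vector-valued space `H¹₀(Ω)ᵈ`, that is, `v ∈ H¹(Ω)ᵈ` with `v = 0` on `∂Ω`. -/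
def IsVecH10 {d : ℕ} (Ω : Set (Space d)) (v : Space d → Space d) : Prop :=
  ∀ i, IsH10 Ω (fun x => v x i)

/-- The divergence of a vector field of `H¹(Ω)ᵈ`. -/
noncomputable def divergence {d : ℕ} (Ω : Set (Space d)) (v : Space d → Space d) (x : Space d) : ℝ :=
  ∑ i, wgrad Ω (fun y => v y i) x i

/-- The inner product `(∇v, ∇w)` in `L²(Ω)` of the gradients of two vector fields. -/
noncomputable def gradInner {d : ℕ} (Ω : Set (Space d)) (v w : Space d → Space d) : ℝ :=
  ∑ i, ∫ x in Ω, inner ℝ (wgrad Ω (fun y => v y i) x) (wgrad Ω (fun y => w y i) x)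

/-- `‖∇v‖²` for a vector field `v`. -/
noncomputable def gradNormSq {d : ℕ} (Ω : Set (Space d)) (v : Space d → Space d) : ℝ :=
  ∑ i, normSq Ω (wgrad Ω (fun y => v y i))

/-- The convective term `(v · ∇) w`; its `i`-th component is `v · ∇ wᵢ`. -/
noncomputable def convect {d : ℕ} (Ω : Set (Space d)) (v w : Space d → Space d) (x : Space d) :
    Space d :=
  WithLp.toLp 2 (fun i => inner ℝ (v x) (wgrad Ω (fun y => w y i) x))

/-- `v · n = 0` on `∂Ω` for a field `v ∈ H¹(Ω)ᵈ`, through Green's formula: on a Lipschitz domain the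
left-hand side is the boundary integral of `q (v · n)`. No regularity of `∂Ω` is needed. -/
def ZeroNormalTrace {d : ℕ} (Ω : Set (Space d)) (v : Space d → Space d) : Prop :=
  ∀ q : Space d → ℝ, IsH1 Ω q →
    (∫ x in Ω, inner ℝ (v x) (wgrad Ω q x)) + (∫ x in Ω, divergence Ω v x * q x) = 0

/-- Weak form of `-Δφ = f` in `Ω`, `∇φ · n = 0` on `∂Ω`. -/
def PoissonNeumann {d : ℕ} (Ω : Set (Space d)) (φ f : Space d → ℝ) : Prop :=
  IsH1 Ω φ ∧ ∀ q : Space d → ℝ, IsH1 Ω q →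
    ∫ x in Ω, inner ℝ (wgrad Ω φ x) (wgrad Ω q x) = ∫ x in Ω, f x * q x

/-- Weak form of `(c - c') / τ - Δc + u · ∇c - s ∇·(c ∇φ) = 0` in `Ω`, `∇c · n = 0` on `∂Ω`, where
`∇φ · n = 0` on `∂Ω` and `s` is `1` or `-1`. That all terms are finite is part of the notion. -/
def ConcentrationEq {d : ℕ} (Ω : Set (Space d)) (τ s : ℝ) (u : Space d → Space d)
    (φ c' c : Space d → ℝ) : Prop :=
  IsH1 Ω c ∧ ∀ q : Space d → ℝ, IsH1 Ω q →
    IntegrableOn (fun x => inner ℝ (u x) (wgrad Ω c x) * q x) Ω ∧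
    IntegrableOn (fun x => c x * inner ℝ (wgrad Ω φ x) (wgrad Ω q x)) Ω ∧
    (∫ x in Ω, (c x - c' x) / τ * q x)
      + (∫ x in Ω, inner ℝ (wgrad Ω c x) (wgrad Ω q x))
      + (∫ x in Ω, inner ℝ (u x) (wgrad Ω c x) * q x)
      + s * (∫ x in Ω, c x * inner ℝ (wgrad Ω φ x) (wgrad Ω q x)) = 0

/-- The Lorentz-type force `(c₁ - c₂) ∇φ`. -/
noncomputable def force {d : ℕ} (Ω : Set (Space d)) (c₁ c₂ φ : Space d → ℝ) (x : Space d) :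
    Space d :=
  (c₁ x - c₂ x) • wgrad Ω φ x

/-- Weak form of `(ū - u) / τ - Δū + ∇p + ξ ((u · ∇) u + (c₁ - c₂) ∇φ) = 0` in `Ω`, `ū = 0` on
`∂Ω`. That all terms are finite is part of the notion. -/
def MomentumEq {d : ℕ} (Ω : Set (Space d)) (τ ξ : ℝ) (u : Space d → Space d)
    (p c₁ c₂ φ : Space d → ℝ) (ubar : Space d → Space d) : Prop :=
  IsVecH10 Ω ubar ∧ ∀ v : Space d → Space d, IsVecH10 Ω v →
    IntegrableOn (fun x => inner ℝ (convect Ω u u x) (v x)) Ω ∧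
    IntegrableOn (fun x => inner ℝ (force Ω c₁ c₂ φ x) (v x)) Ω ∧
    (∫ x in Ω, inner ℝ ((1 / τ) • (ubar x - u x)) (v x))
      + gradInner Ω ubar v
      + (∫ x in Ω, inner ℝ (wgrad Ω p x) (v x))
      + ξ * ((∫ x in Ω, inner ℝ (convect Ω u u x) (v x))
        + (∫ x in Ω, inner ℝ (force Ω c₁ c₂ φ x) (v x))) = 0

/-- `E(φ) = ½ ‖∇φ‖² + C₀`. -/
noncomputable def potentialEnergy {d : ℕ} (Ω : Set (Space d)) (C₀ : ℝ) (φ : Space d → ℝ) : ℝ :=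
  1 / 2 * normSq Ω (wgrad Ω φ) + C₀

/-- Admissible initial values: concentrations in `L²(Ω)`, the potential obtained from them, a
divergence-free velocity in `H¹(Ω)ᵈ` tangential at `∂Ω`, and a pressure in `H¹(Ω)`. -/
structure IsInitial {d : ℕ} (Ω : Set (Space d)) (c₁ c₂ φ : Space d → ℝ) (u : Space d → Space d)
    (p : Space d → ℝ) : Prop where
  conc₁ : IsL2 Ω c₁
  conc₂ : IsL2 Ω c₂
  potential : PoissonNeumann Ω φ (fun x => c₁ x - c₂ x)
  velocity : IsVecH1 Ω u
  div_free : ∀ᵐ x ∂(volume.restrict Ω), divergence Ω u x = 0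
  normal : ZeroNormalTrace Ω u
  pressure : IsH1 Ω p

/-- One time step of the scheme: from `(c₁, c₂, φ, u, p, r)` at the old time level to
`(c₁', c₂', φ', ū', u', p', r')` at the new one. -/
structure IsStep {d : ℕ} (Ω : Set (Space d)) (τ C₀ : ℝ)
    (c₁ c₂ φ : Space d → ℝ) (u : Space d → Space d) (p : Space d → ℝ) (r : ℝ)
    (c₁' c₂' φ' : Space d → ℝ) (ubar' u' : Space d → Space d) (p' : Space d → ℝ) (r' : ℝ) :
    Prop where
  conc₁ : ConcentrationEq Ω τ 1 u φ c₁ c₁'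
  conc₂ : ConcentrationEq Ω τ (-1) u φ c₂ c₂'
  potential : PoissonNeumann Ω φ' (fun x => c₁' x - c₂' x)
  momentum : MomentumEq Ω τ (r' / √(potentialEnergy Ω C₀ φ')) u p c₁ c₂ φ ubar'
  velocity : IsVecH1 Ω u'
  pressure : IsH1 Ω p'
  projection : ∀ᵐ x ∂(volume.restrict Ω),
    (1 / τ) • (u' x - ubar' x) + wgrad Ω p' x - wgrad Ω p x = 0
  div_free : ∀ᵐ x ∂(volume.restrict Ω), divergence Ω u' x = 0
  normal : ZeroNormalTrace Ω u'
  /-- The next two facts make the equation for the auxiliary variable meaningful. -/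
  aux_ne_zero : r' ≠ 0
  dissipation_finite : IntegrableOn (fun x => (c₁' x + c₂' x) * ‖wgrad Ω φ' x‖ ^ 2) Ω
  auxiliary : (r' - r) / τ =
    1 / (2 * √(potentialEnergy Ω C₀ φ')) *
        ((∫ x in Ω, inner ℝ (convect Ω u u x) (ubar' x))
          + (∫ x in Ω, inner ℝ (force Ω c₁ c₂ φ x) (ubar' x)))
      - 1 / (2 * r') *
        (normSq Ω (fun x => c₁' x - c₂' x)
          + (∫ x in Ω, (c₁' x + c₂' x) * ‖wgrad Ω φ' x‖ ^ 2))

/-- `(c₁ⁿ, c₂ⁿ, φⁿ, ūⁿ, uⁿ, pⁿ, rⁿ)`, `0 ≤ n ≤ N`, is a solution of the first-order SAV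
pressure-correction scheme with time step `τ` (the value of `ū⁰` plays no role). -/
structure IsSchemeSolution {d : ℕ} (Ω : Set (Space d)) (τ C₀ : ℝ) (N : ℕ)
    (c₁ c₂ φ : ℕ → Space d → ℝ) (ubar u : ℕ → Space d → Space d) (p : ℕ → Space d → ℝ)
    (r : ℕ → ℝ) : Prop where
  initial : IsInitial Ω (c₁ 0) (c₂ 0) (φ 0) (u 0) (p 0)
  step : ∀ n < N, IsStep Ω τ C₀ (c₁ n) (c₂ n) (φ n) (u n) (p n) (r n)
    (c₁ (n + 1)) (c₂ (n + 1)) (φ (n + 1)) (ubar (n + 1)) (u (n + 1)) (p (n + 1)) (r (n + 1))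

/-- The discrete energy `½ ‖u‖² + ½ τ² ‖∇p‖² + |r|²`. -/
noncomputable def energy {d : ℕ} (Ω : Set (Space d)) (τ : ℝ) (u : Space d → Space d)
    (p : Space d → ℝ) (r : ℝ) : ℝ :=
  1 / 2 * normSq Ω u + τ ^ 2 / 2 * normSq Ω (wgrad Ω p) + |r| ^ 2

end SAVScheme

/-! Non-negativity comes from an `L¹`-type test. The natural choice `min c 0` would turn the drift
into half the integral of `f * (min c 0) ^ 2`, where `f` is the old charge density; this has no sign
and is harmless only for small `τ`. Instead the concentration equation is tested with `cutoff ε ∘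
c`, a decreasing `C¹` approximation of the indicator of `{c < 0}`. Diffusion then has a sign, and
convection is `u` paired with the gradient of a function of `c`, hence zero. The drift is `∇φ`
paired with the gradient of `cutoffRemainder ε ∘ c`; the Poisson equation replaces it by the
integral of `f` times a function of size `O(ε)`. As `ε → 0`, the integral of the negative part of
`c` is at most zero, for every `τ`.

Mass conservation is the test with the constant `1`. For the energy, the momentum equation is tested
with `ū`, the identity `u' + τ∇p' = ū + τ∇p` is squared, and the auxiliary equation is multiplied by
`2r'`: the nonlinear terms cancel and only non-negative squares are dropped.

The analytic tool is the chain rule `IsWeakGrad.comp` on an arbitrary open set, proved by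
mollification. The chain is `IsH1.comp`, `ConcentrationEq.integral_neg_mul_cutoff_le`,
`ConcentrationEq.nonneg`, with `IsStep.energy_sub_le` for the energy. -/

namespace SAVScheme

open scoped Convolution

/-! ### Mollification and its convergence in `L¹`. -/

section Mollification

open ContinuousLinearMap

variable {d : ℕ} {F : Type*} [NormedAddCommGroup F] [NormedSpace ℝ F]

/-- Mollification of `f` by a normalised bump function. -/
noncomputable def mollify (φ : ContDiffBump (0 : Space d)) (f : Space d → F) : Space d → F :=
  φ.normed volume ⋆[lsmul ℝ ℝ, volume] f

theorem integrable_mollify (φ : ContDiffBump (0 : Space d)) {f : Space d → F}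
    (hf : Integrable f) : Integrable (mollify φ f) :=
  φ.integrable_normed.integrable_convolution _ hf

theorem continuous_mollify (φ : ContDiffBump (0 : Space d)) {f : Space d → F}
    (hf : Integrable f) : Continuous (mollify φ f) :=
  φ.hasCompactSupport_normed.continuous_convolution_left _ φ.continuous_normed
    hf.locallyIntegrable

theorem mollify_sub (φ : ContDiffBump (0 : Space d)) {f g : Space d → F}
    (hf : Integrable f) (hg : Integrable g) : mollify φ (f - g) = mollify φ f - mollify φ g := by
  have h (k : Space d → F) (hk : Integrable k) (x : Space d) :
      ConvolutionExistsAt (φ.normed volume) k x (lsmul ℝ ℝ) volume :=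
    φ.hasCompactSupport_normed.convolutionExists_left _ φ.continuous_normed hk.locallyIntegrable x
  ext x
  simp only [mollify, convolution, Pi.sub_apply, map_sub]
  exact integral_sub (h f hf x) (h g hg x)

/-- Mollification does not increase the norm of `L¹`. -/
theorem integral_norm_mollify_le [CompleteSpace F] (φ : ContDiffBump (0 : Space d)) {f : Space d → F}
    (hf : Integrable f) : ∫ x, ‖mollify φ f x‖ ≤ ∫ x, ‖f x‖ := by
  have h1 : ∫ x, mollify φ (fun y => ‖f y‖) x = ∫ x, ‖f x‖ := by
    unfold mollify
    rw [integral_convolution (L := lsmul ℝ ℝ) φ.integrable_normed hf.norm]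
    simp [φ.integral_normed]
  rw [← h1]
  refine integral_mono (integrable_mollify φ hf).norm (integrable_mollify φ hf.norm) fun x => ?_
  refine (norm_integral_le_integral_norm _).trans (le_of_eq ?_)
  refine integral_congr_ae (Eventually.of_forall fun t => ?_)
  simp [norm_smul, abs_of_nonneg (φ.nonneg_normed t)]

theorem mollify_eq_zero [CompleteSpace F] (φ : ContDiffBump (0 : Space d)) {f : Space d → F} {x : Space d}
    (h : ∀ y ∈ Metric.ball x φ.rOut, f y = 0) : mollify φ f x = 0 := by
  have := ContDiffBump.normed_convolution_eq_right (φ := φ) (g := f) (x₀ := x) (μ := volume)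
    (fun y hy => by rw [h y hy, h x (Metric.mem_ball_self φ.rOut_pos)])
  rw [mollify, this, h x (Metric.mem_ball_self φ.rOut_pos)]

theorem tendsto_integral_norm_mollify_sub_of_continuous [CompleteSpace F] {φ : ℕ → ContDiffBump (0 : Space d)}
    (hφ : Tendsto (fun n => (φ n).rOut) atTop (𝓝 0)) {f : Space d → F} (hf : Continuous f)
    (hfc : HasCompactSupport f) :
    Tendsto (fun n => ∫ x, ‖mollify (φ n) f x - f x‖) atTop (𝓝 0) := by
  set S := Metric.cthickening 1 (tsupport f) with hS
  have hSc : IsCompact S := IsCompact.cthickening hfc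
  have hunif := hfc.uniformContinuous_of_continuous hf
  rw [Metric.tendsto_nhds]
  intro ε hε
  -- The error is at most `δ` on `S` and zero off it; the `+ 1` keeps the quotient defined and the
  -- final inequality strict.
  set δ := ε / (volume.real S + 1) with hδ
  have hS0 : 0 ≤ volume.real S := measureReal_nonneg
  have hδ0 : 0 < δ := by positivity
  obtain ⟨ρ, hρ, hρ'⟩ := Metric.uniformContinuous_iff.1 hunif δ hδ0
  filter_upwards [hφ.eventually (gt_mem_nhds (lt_min hρ one_pos))] with n hn
  have hn1 : (φ n).rOut < ρ := hn.trans_le (min_le_left _ _)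
  have hn2 : (φ n).rOut < 1 := hn.trans_le (min_le_right _ _)
  have hpt (x : Space d) : ‖mollify (φ n) f x - f x‖ ≤ S.indicator (fun _ => δ) x := by
    by_cases hx : x ∈ S
    · rw [Set.indicator_of_mem hx, ← dist_eq_norm]
      refine (φ n).dist_normed_convolution_le hf.aestronglyMeasurable fun y hy => ?_
      exact (hρ' ((Metric.mem_ball.1 hy).trans hn1)).le
    · have h0 : ∀ y ∈ Metric.ball x (φ n).rOut, f y = 0 := by
        intro y hy
        by_contra hne
        refine hx (Metric.mem_cthickening_of_dist_le x y 1 _ (subset_tsupport f hne) ?_)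
        rw [dist_comm]
        exact ((Metric.mem_ball.1 hy).trans hn2).le
      rw [Set.indicator_of_notMem hx, mollify_eq_zero _ h0,
        h0 x (Metric.mem_ball_self (φ n).rOut_pos)]
      simp
  have hfi : Integrable f := hf.integrable_of_hasCompactSupport hfc
  have hle : ∫ x, ‖mollify (φ n) f x - f x‖ ≤ δ * volume.real S := by
    refine (integral_mono ((integrable_mollify _ hfi).sub hfi).norm
      ((integrable_indicator_iff hSc.measurableSet).2
        (integrableOn_const hSc.measure_lt_top.ne)) hpt).trans (le_of_eq ?_)
    rw [integral_indicator hSc.measurableSet]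
    simp [mul_comm]
  rw [Real.dist_0_eq_abs, abs_of_nonneg (integral_nonneg fun _ => norm_nonneg _)]
  refine hle.trans_lt ?_
  rw [hδ, div_mul_eq_mul_div, div_lt_iff₀ (by positivity)]
  nlinarith

/-- Mollifications converge in `L¹`. -/
theorem tendsto_integral_norm_mollify_sub [CompleteSpace F] {φ : ℕ → ContDiffBump (0 : Space d)}
    (hφ : Tendsto (fun n => (φ n).rOut) atTop (𝓝 0)) {f : Space d → F} (hf : Integrable f) :
    Tendsto (fun n => ∫ x, ‖mollify (φ n) f x - f x‖) atTop (𝓝 0) := by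
  rw [Metric.tendsto_nhds]
  intro ε hε
  obtain ⟨g, hgc, hfg, hg, hgi⟩ := hf.exists_hasCompactSupport_integral_sub_le
    (show (0 : ℝ) < ε / 3 by positivity)
  filter_upwards [(tendsto_integral_norm_mollify_sub_of_continuous hφ hg hgc).eventually
    (gt_mem_nhds (show (0 : ℝ) < ε / 3 by positivity))] with n hn
  rw [Real.dist_0_eq_abs, abs_of_nonneg (integral_nonneg fun _ => norm_nonneg _)]
  have h1 : Integrable fun x => ‖mollify (φ n) (f - g) x‖ :=
    (integrable_mollify _ (hf.sub hgi)).norm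
  have h2 : Integrable fun x => ‖mollify (φ n) g x - g x‖ :=
    ((integrable_mollify _ hgi).sub hgi).norm
  have h3 : Integrable fun x => ‖f x - g x‖ := (hf.sub hgi).norm
  have hle : ∫ x, ‖mollify (φ n) f x - f x‖ ≤
      (∫ x, ‖mollify (φ n) (f - g) x‖) + (∫ x, ‖mollify (φ n) g x - g x‖)
        + ∫ x, ‖f x - g x‖ := by
    rw [← integral_add h1 h2, ← integral_add (by exact h1.add h2) h3]
    refine integral_mono ((integrable_mollify _ hf).sub hf).norm ((h1.add h2).add h3) fun x => ?_
    have hx : mollify (φ n) f x - f x =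
        mollify (φ n) (f - g) x + (mollify (φ n) g x - g x) - (f x - g x) := by
      rw [mollify_sub _ hf hgi, Pi.sub_apply]
      abel
    simp only [hx]
    exact (norm_sub_le _ _).trans (by gcongr; exact norm_add_le _ _)
  have h4 := integral_norm_mollify_le (φ n) (hf.sub hgi)
  simp only [Pi.sub_apply] at h4
  linarith

end Mollification

/-! ### Mollified weak gradients and the chain rule. -/

theorem gradient_comp_const_sub {d : ℕ} {η : Space d → ℝ} (hη : Differentiable ℝ η)
    (x t : Space d) : ∇ (fun y => η (x - y)) t = - ∇ η (x - t) := by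
  refine HasGradientAt.gradient ?_
  rw [hasGradientAt_iff_hasFDerivAt, map_neg]
  have h1 := (hη (x - t)).hasGradientAt.hasFDerivAt
  have h2 : HasFDerivAt (fun y : Space d => x - y) (-(ContinuousLinearMap.id ℝ (Space d))) t :=
    (hasFDerivAt_id t).const_sub x
  refine (HasFDerivAt.comp t h1 h2).congr_fderiv ?_
  ext v
  simp

/-- The mollification of a weakly differentiable function has the mollified gradient, away from the
boundary. -/
theorem hasGradientAt_mollify {d : ℕ} {Ω : Set (Space d)} (hΩ : IsOpen Ω)
    {f : Space d → ℝ} {g : Space d → Space d} (hf : IntegrableOn f Ω) (hfg : IsWeakGrad Ω f g)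
    (φ : ContDiffBump (0 : Space d)) {x : Space d} (hx : Metric.closedBall x φ.rOut ⊆ Ω) :
    HasGradientAt (mollify φ (Ω.indicator f)) (mollify φ (Ω.indicator g) x) x := by
  set η := φ.normed volume with hη
  have hsm : ContDiff ℝ ∞ η := φ.contDiff_normed
  have hdiff : Differentiable ℝ η := hsm.differentiable (by simp)
  have hfi : Integrable (Ω.indicator f) := (integrable_indicator_iff hΩ.measurableSet).2 hf
  -- The reflected kernel is itself admissible in the definition of the weak gradient, because the
  -- ball around `x` lies in `Ω`.
  have htest : IsTest Ω (fun t => η (x - t)) := by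
    have hts : tsupport (fun t => η (x - t)) ⊆ Metric.closedBall x φ.rOut := by
      refine closure_minimal (fun t ht => ?_) Metric.isClosed_closedBall
      have h1 : x - t ∈ Function.support η := ht
      rw [hη, φ.support_normed_eq] at h1
      rw [Metric.mem_closedBall, dist_comm, dist_eq_norm]
      simpa using (mem_ball_zero_iff.1 h1).le
    refine ⟨hsm.comp (contDiff_const.sub contDiff_id), ?_, hts.trans hx⟩
    exact (isCompact_closedBall x φ.rOut).of_isClosed_subset (isClosed_tsupport _) hts
  have hw := hfg.2 _ htest
  rw [hasGradientAt_iff_hasFDerivAt]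
  refine ((φ.hasCompactSupport_normed (μ := volume)).hasFDerivAt_convolution_left
    (ContinuousLinearMap.lsmul ℝ ℝ) (hsm.of_le (by simp)) hfi.locallyIntegrable x).congr_fderiv ?_
  rw [convolution_eq_swap, mollify, convolution_eq_swap]
  have e1 : (∫ t, (ContinuousLinearMap.precompL (Space d) (ContinuousLinearMap.lsmul ℝ ℝ)
      (fderiv ℝ η (x - t))) (Ω.indicator f t)) =
      ∫ t, InnerProductSpace.toDual ℝ (Space d) (Ω.indicator f t • ∇ η (x - t)) := by
    refine integral_congr_ae (Eventually.of_forall fun t => ?_)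
    ext v
    simp [mul_comm]
  rw [e1]
  have e2 := (InnerProductSpace.toDual ℝ (Space d)).toContinuousLinearEquiv.integral_comp_comm
    (μ := volume) (fun t => Ω.indicator f t • ∇ η (x - t))
  refine Eq.trans e2 ?_
  refine congrArg (InnerProductSpace.toDual ℝ (Space d)) ?_
  have e3 : ∀ (t : Space d), Ω.indicator f t • ∇ η (x - t) =
      - Ω.indicator (fun t => f t • ∇ (fun y => η (x - y)) t) t := by
    intro t
    by_cases ht : t ∈ Ω
    · simp [ht, gradient_comp_const_sub hdiff]
    · simp [ht]
  have e4 : ∀ (t : Space d), ContinuousLinearMap.lsmul ℝ ℝ (η (x - t)) (Ω.indicator g t) =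
      Ω.indicator (fun t => η (x - t) • g t) t := by
    intro t
    by_cases ht : t ∈ Ω <;> simp [ht]
  simp only [e3, integral_neg, integral_indicator hΩ.measurableSet, hw, neg_neg]
  rw [← integral_indicator hΩ.measurableSet]
  exact integral_congr_ae (Eventually.of_forall fun t => (e4 t).symm)

theorem continuous_gradient {d : ℕ} {f : Space d → ℝ} (hf : ContDiff ℝ 1 f) :
    Continuous (∇ f) :=
  (InnerProductSpace.toDual ℝ (Space d)).symm.continuous.comp (hf.continuous_fderiv (by simp))

theorem tsupport_gradient_subset {d : ℕ} (f : Space d → ℝ) : tsupport (∇ f) ⊆ tsupport f := by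
  refine (closure_mono fun x hx => ?_).trans (tsupport_fderiv_subset ℝ (f := f))
  rw [Function.mem_support] at hx ⊢
  intro h
  exact hx (by simp [gradient, h])

/-- Integration by parts against a test function, for a function differentiable on its support. -/
theorem integral_smul_gradient_eq_neg {d : ℕ} {Ω : Set (Space d)} {ψ : Space d → ℝ}
    (hψ : IsTest Ω ψ) {f : Space d → ℝ} {g : Space d → Space d} (hfc : Continuous f)
    (hgc : Continuous g) (hf : ∀ x ∈ tsupport ψ, HasGradientAt f (g x) x) :
    ∫ x, f x • ∇ ψ x = - ∫ x, ψ x • g x := by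
  have hψ1 : ContDiff ℝ 1 ψ := hψ.smooth.of_le (by simp)
  have hgψ := continuous_gradient hψ1
  have hgψs : HasCompactSupport (∇ ψ) :=
    hψ.compact.of_isClosed_subset (isClosed_tsupport _) (tsupport_gradient_subset ψ)
  have i1 : Integrable fun x => f x • ∇ ψ x :=
    (hfc.smul hgψ).integrable_of_hasCompactSupport hgψs.smul_left
  have i2 : Integrable fun x => ψ x • g x :=
    (hψ1.continuous.smul hgc).integrable_of_hasCompactSupport hψ.compact.smul_right
  have i3 : Integrable fun x => f x * ψ x :=
    (hfc.mul hψ1.continuous).integrable_of_hasCompactSupport hψ.compact.mul_left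
  refine ext_inner_left ℝ fun v => ?_
  rw [inner_neg_right, ← integral_inner i1 v, ← integral_inner i2 v]
  have key := integral_bilinear_hasFDerivAt_right_eq_neg_left_of_integrable (μ := volume)
    (f := f) (f' := fun x => InnerProductSpace.toDual ℝ (Space d) (g x)) (g := ψ)
    (g' := fderiv ℝ ψ) (v := v) (B := ContinuousLinearMap.mul ℝ ℝ)
    (by
      refine (i2.const_inner v).congr (Eventually.of_forall fun x => ?_)
      simp [inner_smul_right, real_inner_comm, mul_comm])
    (by
      refine (i1.const_inner v).congr (Eventually.of_forall fun x => ?_)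
      simp [inner_smul_right, inner_gradient_right])
    i3 (fun x hx => (hf x hx).hasFDerivAt)
    (fun x _ => ((hψ1.differentiable (by simp)) x).hasFDerivAt)
  simp only [ContinuousLinearMap.mul_apply', InnerProductSpace.toDual_apply_apply] at key
  refine Eq.trans ?_ (key.trans ?_)
  · exact integral_congr_ae (Eventually.of_forall fun x => by
      simp [inner_smul_right, inner_gradient_right])
  · congr 1
    exact integral_congr_ae (Eventually.of_forall fun x => by
      simp [inner_smul_right, real_inner_comm, mul_comm])

/-- Bump functions centred at the origin whose supports shrink to it. -/
noncomputable def shrinkingBump (d : ℕ) (n : ℕ) : ContDiffBump (0 : Space d) where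
  rIn := 1 / ((n : ℝ) + 1)
  rOut := 2 * (1 / ((n : ℝ) + 1))
  rIn_pos := by positivity
  rIn_lt_rOut := by
    have : (0 : ℝ) < 1 / ((n : ℝ) + 1) := by positivity
    linarith

theorem tendsto_rOut_shrinkingBump (d : ℕ) :
    Tendsto (fun n => (shrinkingBump d n).rOut) atTop (𝓝 0) := by
  simpa [shrinkingBump] using (tendsto_one_div_add_atTop_nhds_zero_nat (𝕜 := ℝ)).const_mul 2

/-- Split `a n • g n` as `a n • (g n - g') + a n • g'`: the first part is small by the uniform
bound, the second converges by domination. It serves for the limit of `K'(fₙ) ∇fₙ`, whose scalar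
factor converges only almost everywhere. -/
theorem tendsto_integral_mul_of_norm_sub {d : ℕ} {F : Type*} [NormedAddCommGroup F]
    [NormedSpace ℝ F] {a : ℕ → Space d → ℝ} {b : Space d → ℝ} {C : ℝ}
    (ham : ∀ n, AEStronglyMeasurable (a n)) (ha : ∀ n x, |a n x| ≤ C)
    (hab : ∀ᵐ x, Tendsto (fun n => a n x) atTop (𝓝 (b x)))
    {g : ℕ → Space d → F} {g' : Space d → F} (hg : ∀ n, Integrable (g n)) (hg' : Integrable g')
    (h : Tendsto (fun n => ∫ x, ‖g n x - g' x‖) atTop (𝓝 0)) :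
    Tendsto (fun n => ∫ x, a n x • g n x) atTop (𝓝 (∫ x, b x • g' x)) := by
  have i1 (n) : Integrable fun x => a n x • (g n x - g' x) :=
    ((hg n).sub hg').bdd_smul _ (ham n) (Eventually.of_forall (ha n))
  have i2 (n) : Integrable fun x => a n x • g' x :=
    hg'.bdd_smul _ (ham n) (Eventually.of_forall (ha n))
  have t1 : Tendsto (fun n => ∫ x, a n x • (g n x - g' x)) atTop (𝓝 0) := by
    have t := h.const_mul C
    rw [mul_zero] at t
    refine squeeze_zero_norm (fun n => ?_) t
    refine (norm_integral_le_integral_norm _).trans ?_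
    rw [← integral_const_mul]
    refine integral_mono (i1 n).norm (((hg n).sub hg').norm.const_mul C) fun x => ?_
    simp only [norm_smul, Real.norm_eq_abs]
    exact mul_le_mul_of_nonneg_right (ha n x) (norm_nonneg _)
  have t2 : Tendsto (fun n => ∫ x, a n x • g' x) atTop (𝓝 (∫ x, b x • g' x)) := by
    refine tendsto_integral_of_dominated_convergence (fun x => C * ‖g' x‖)
      (fun n => (i2 n).aestronglyMeasurable) (hg'.norm.const_mul C) (fun n => ?_) ?_
    · refine Eventually.of_forall fun x => ?_
      simp only [norm_smul, Real.norm_eq_abs]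
      exact mul_le_mul_of_nonneg_right (ha n x) (norm_nonneg _)
    · filter_upwards [hab] with x hx
      exact hx.smul_const _
  have t := t1.add t2
  rw [zero_add] at t
  refine t.congr fun n => ?_
  rw [← integral_add (i1 n) (i2 n)]
  simp [smul_sub]

/-- The chain rule for weak gradients. -/
theorem IsWeakGrad.comp {d : ℕ} {Ω : Set (Space d)} (hΩ : IsOpen Ω) {f : Space d → ℝ}
    {g : Space d → Space d} (hf : IntegrableOn f Ω) (hgi : IntegrableOn g Ω)
    (hfg : IsWeakGrad Ω f g) {K K' : ℝ → ℝ} (hK : ∀ t, HasDerivAt K (K' t) t)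
    (hK' : Continuous K') {M : ℝ} (hM : ∀ t, |K' t| ≤ M) :
    IsWeakGrad Ω (fun x => K (f x)) (fun x => K' (f x) • g x) := by
  have hfm : AEStronglyMeasurable f (volume.restrict Ω) := hf.aestronglyMeasurable
  have hKc : Continuous K := continuous_iff_continuousAt.2 fun t => (hK t).continuousAt
  refine ⟨?_, fun ψ hψ => ?_⟩
  · refine MemLp.of_le_mul (c := M) hfg.1
      ((hK'.comp_aestronglyMeasurable hfm).smul hgi.aestronglyMeasurable)
      (Eventually.of_forall fun x => ?_)
    simp only [norm_smul, Real.norm_eq_abs]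
    exact mul_le_mul_of_nonneg_right (hM _) (norm_nonneg _)
  have hψ1 : ContDiff ℝ 1 ψ := hψ.smooth.of_le (by simp)
  have hψc := hψ1.continuous
  have hgψ := continuous_gradient hψ1
  have hψs : ∀ x ∉ Ω, ψ x = 0 := fun x hx => image_eq_zero_of_notMem_tsupport
    fun h => hx (hψ.support h)
  have hgψs : ∀ x ∉ Ω, ∇ ψ x = 0 := fun x hx => image_eq_zero_of_notMem_tsupport
    fun h => hx (hψ.support (tsupport_gradient_subset ψ h))
  have hgψcs : HasCompactSupport (∇ ψ) :=
    hψ.compact.of_isClosed_subset (isClosed_tsupport _) (tsupport_gradient_subset ψ)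
  -- The extension by zero need not be weakly differentiable across the boundary; gradients of its
  -- mollifications are used only on the support of `ψ`.
  set f₁ := Ω.indicator f with hf₁
  set g₁ := Ω.indicator g with hg₁
  have if₁ : Integrable f₁ := (integrable_indicator_iff hΩ.measurableSet).2 hf
  have ig₁ : Integrable g₁ := (integrable_indicator_iff hΩ.measurableSet).2 hgi
  set φ := shrinkingBump d
  have hφ := tendsto_rOut_shrinkingBump d
  obtain ⟨C, hC⟩ := hψ.compact.exists_bound_of_continuous hψc
  obtain ⟨C', hC'⟩ := hgψcs.exists_bound_of_continuous hgψ
  have hKL (s t : ℝ) : |K s - K t| ≤ M * |s - t| := by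
    have := convex_univ.norm_image_sub_le_of_norm_hasDerivWithin_le (f := K) (f' := K') (C := M)
      (fun x _ => (hK x).hasDerivWithinAt) (fun x _ => hM x) (Set.mem_univ t) (Set.mem_univ s)
    simpa using this
  have hM0 : 0 ≤ M := (abs_nonneg _).trans (hM 0)
  have ae : ∀ᵐ x, Tendsto (fun n => mollify (φ n) f₁ x) atTop (𝓝 (f₁ x)) :=
    -- The value `2` is the ratio of outer to inner radius in `shrinkingBump`.
    ContDiffBump.ae_convolution_tendsto_right_of_locallyIntegrable (K := 2) hφ
      (Eventually.of_forall fun n => le_refl _) if₁.locallyIntegrable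
  have right : Tendsto (fun n => ∫ x, (ψ x * K' (mollify (φ n) f₁ x)) • mollify (φ n) g₁ x) atTop
      (𝓝 (∫ x, (ψ x * K' (f₁ x)) • g₁ x)) := by
    refine tendsto_integral_mul_of_norm_sub (C := C * M)
      (fun n => (hψc.mul (hK'.comp (continuous_mollify _ if₁))).aestronglyMeasurable)
      (fun n x => ?_) ?_ (fun n => integrable_mollify _ ig₁) ig₁
      (tendsto_integral_norm_mollify_sub hφ ig₁)
    · refine (abs_mul _ _).trans_le ?_
      exact mul_le_mul (hC x) (hM _) (abs_nonneg _) ((norm_nonneg _).trans (hC x))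
    · filter_upwards [ae] with x hx
      exact ((hK'.tendsto _).comp hx).const_mul _
  have left : Tendsto (fun n => ∫ x, K (mollify (φ n) f₁ x) • ∇ ψ x) atTop
      (𝓝 (∫ x, K (f₁ x) • ∇ ψ x)) := by
    have i0 : Integrable fun x => K 0 • ∇ ψ x :=
      (hgψ.integrable_of_hasCompactSupport hgψcs).smul (K 0)
    have i1 {k : Space d → ℝ} (hk : Integrable k) : Integrable fun x => K (k x) • ∇ ψ x := by
      -- Only `K ∘ k - K 0` is dominated by `M * |k|`; the constant `K 0` is handled through the
      -- compact support of `∇ ψ`.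
      have : Integrable fun x => (K (k x) - K 0) • ∇ ψ x := by
        have hKk : Integrable fun x => K (k x) - K 0 := by
          refine (hk.norm.const_mul M).mono'
            ((hKc.comp_aestronglyMeasurable hk.aestronglyMeasurable).sub
              aestronglyMeasurable_const) (Eventually.of_forall fun x => ?_)
          simpa using hKL (k x) 0
        exact hKk.smul_bdd (C := C') hgψ.aestronglyMeasurable (Eventually.of_forall hC')
      refine (this.add i0).congr (Eventually.of_forall fun x => ?_)
      simp [sub_smul]
    rw [tendsto_iff_norm_sub_tendsto_zero]
    have t := (tendsto_integral_norm_mollify_sub hφ if₁).const_mul (M * C')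
    rw [mul_zero] at t
    refine squeeze_zero (fun _ => norm_nonneg _) (fun n => ?_) t
    rw [← integral_sub (i1 (integrable_mollify _ if₁)) (i1 if₁)]
    refine (norm_integral_le_integral_norm _).trans ?_
    rw [← integral_const_mul]
    refine integral_mono ((i1 (integrable_mollify _ if₁)).sub (i1 if₁)).norm
      (((integrable_mollify _ if₁).sub if₁).norm.const_mul _) fun x => ?_
    simp only [← sub_smul, norm_smul, Real.norm_eq_abs]
    calc |K (mollify (φ n) f₁ x) - K (f₁ x)| * ‖∇ ψ x‖
        ≤ (M * |mollify (φ n) f₁ x - f₁ x|) * C' :=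
          mul_le_mul (hKL _ _) (hC' x) (norm_nonneg _) (by positivity)
      _ = _ := by ring
  have hev : ∀ᶠ n in atTop, ∫ x, K (mollify (φ n) f₁ x) • ∇ ψ x =
      - ∫ x, (ψ x * K' (mollify (φ n) f₁ x)) • mollify (φ n) g₁ x := by
    -- Once the mollification radius is below `δ`, every ball centred on the support of `ψ` stays in
    -- `Ω`.
    obtain ⟨δ, hδ, hδΩ⟩ := hψ.compact.isCompact.exists_cthickening_subset_open hΩ hψ.support
    filter_upwards [hφ.eventually (gt_mem_nhds hδ)] with n hn
    rw [integral_smul_gradient_eq_neg hψ (f := fun x => K (mollify (φ n) f₁ x))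
      (hKc.comp (continuous_mollify _ if₁))
      (g := fun x => K' (mollify (φ n) f₁ x) • mollify (φ n) g₁ x)
      ((hK'.comp (continuous_mollify _ if₁)).smul (continuous_mollify _ ig₁))]
    · simp only [mul_smul]
    · intro x hx
      have hb : Metric.closedBall x (φ n).rOut ⊆ Ω := by
        refine Set.Subset.trans (fun y hy => ?_) hδΩ
        exact Metric.mem_cthickening_of_dist_le y x δ _ hx ((Metric.mem_closedBall.1 hy).trans hn.le)
      have h1 := (hasGradientAt_mollify hΩ hf hfg (φ n) hb).hasFDerivAt
      rw [hasGradientAt_iff_hasFDerivAt]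
      refine ((hK _).comp_hasFDerivAt x h1).congr_fderiv ?_
      ext v
      simp [hf₁, hg₁]
  have heq := tendsto_nhds_unique left (right.neg.congr' (hev.mono fun n hn => hn.symm))
  have e1 : ∫ x in Ω, K (f₁ x) • ∇ ψ x = ∫ x, K (f₁ x) • ∇ ψ x :=
    setIntegral_eq_integral_of_forall_compl_eq_zero fun x hx => by simp [hgψs x hx]
  have e2 : ∫ x in Ω, (ψ x * K' (f₁ x)) • g₁ x = ∫ x, (ψ x * K' (f₁ x)) • g₁ x :=
    setIntegral_eq_integral_of_forall_compl_eq_zero fun x hx => by simp [hψs x hx]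
  rw [← e1, ← e2] at heq
  refine (setIntegral_congr_fun hΩ.measurableSet fun x hx => ?_).trans (heq.trans ?_)
  · simp [hf₁, hx]
  · congr 1
    refine setIntegral_congr_fun hΩ.measurableSet fun x hx => ?_
    simp [hf₁, hg₁, hx, mul_smul]

/-! ### Calculus in `H¹(Ω)`. -/

section Sobolev

variable {d : ℕ} {Ω : Set (Space d)}

theorem isFiniteMeasure_restrict (hΩb : Bornology.IsBounded Ω) :
    IsFiniteMeasure (volume.restrict Ω) :=
  ⟨by simpa using hΩb.measure_lt_top⟩

theorem IsL2.integrableOn {F : Type*} [NormedAddCommGroup F] (hΩb : Bornology.IsBounded Ω)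
    {f : Space d → F} (hf : IsL2 Ω f) : IntegrableOn f Ω :=
  have := isFiniteMeasure_restrict hΩb
  MemLp.integrable (by norm_num) hf

theorem IsL2.integrableOn_norm_sq {F : Type*} [NormedAddCommGroup F] {f : Space d → F}
    (hf : IsL2 Ω f) : IntegrableOn (fun x => ‖f x‖ ^ 2) Ω :=
  (memLp_two_iff_integrable_sq_norm hf.1).1 hf

theorem IsL2.integrableOn_inner {F : Type*} [NormedAddCommGroup F] [InnerProductSpace ℝ F]
    {f g : Space d → F} (hf : IsL2 Ω f) (hg : IsL2 Ω g) :
    IntegrableOn (fun x => inner ℝ (f x) (g x)) Ω :=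
  (MemLp.integrable_mul hf.norm hg.norm).mono' (hf.1.inner hg.1)
    (Eventually.of_forall fun x => norm_inner_le_norm (𝕜 := ℝ) (f x) (g x))

theorem IsH1.isWeakGrad {f : Space d → ℝ} (hf : IsH1 Ω f) : IsWeakGrad Ω f (wgrad Ω f) := by
  rw [wgrad, dif_pos hf.2]
  exact hf.2.choose_spec

/-- The fundamental lemma of the calculus of variations applied to the difference. It identifies the
chosen `wgrad` with any explicitly computed gradient. -/
theorem IsWeakGrad.ae_eq (hΩ : IsOpen Ω) (hΩb : Bornology.IsBounded Ω) {f : Space d → ℝ}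
    {g g' : Space d → Space d} (hg : IsWeakGrad Ω f g) (hg' : IsWeakGrad Ω f g') :
    ∀ᵐ x ∂(volume.restrict Ω), g x = g' x := by
  have ig := hg.1.integrableOn hΩb
  have ig' := hg'.1.integrableOn hΩb
  have h := hΩ.ae_eq_zero_of_integral_contDiff_smul_eq_zero (μ := volume)
    (f := fun x => g x - g' x) (ig.sub ig').locallyIntegrableOn (fun ψ hs hc ht => by
      have hψ : IsTest Ω ψ := ⟨hs, hc, ht⟩
      obtain ⟨C, hC⟩ := hc.exists_bound_of_continuous hs.continuous
      have i (k : Space d → Space d) (hk : IntegrableOn k Ω) :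
          Integrable (fun x => ψ x • k x) (volume.restrict Ω) :=
        Integrable.bdd_smul hk C hs.continuous.aestronglyMeasurable (Eventually.of_forall hC)
      have e : ∫ x in Ω, ψ x • (g x - g' x) = ∫ x, ψ x • (g x - g' x) :=
        setIntegral_eq_integral_of_forall_compl_eq_zero fun x hx => by
          rw [image_eq_zero_of_notMem_tsupport fun h => hx (ht h), zero_smul]
      rw [← e]
      simp only [smul_sub]
      rw [integral_sub (i g ig) (i g' ig'), sub_eq_zero]
      exact neg_injective ((hg.2 ψ hψ).symm.trans (hg'.2 ψ hψ)))
  rw [ae_restrict_iff' hΩ.measurableSet]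
  filter_upwards [h] with x hx hxΩ
  exact sub_eq_zero.1 (hx hxΩ)

theorem isWeakGrad_const (c : ℝ) : IsWeakGrad Ω (fun _ => c) 0 := by
  refine ⟨MemLp.zero, fun ψ hψ => ?_⟩
  have h := integral_smul_gradient_eq_neg hψ (f := fun _ => c) (g := fun _ => 0)
    continuous_const continuous_const (fun x _ => hasGradientAt_const x c)
  have e : ∫ x in Ω, c • ∇ ψ x = ∫ x, c • ∇ ψ x :=
    setIntegral_eq_integral_of_forall_compl_eq_zero fun x hx => by
      rw [image_eq_zero_of_notMem_tsupport
        fun h => hx (hψ.support (tsupport_gradient_subset ψ h)), smul_zero]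
  rw [e, h]
  simp

theorem isH1_const (hΩb : Bornology.IsBounded Ω) (c : ℝ) : IsH1 Ω (fun _ => c) :=
  have := isFiniteMeasure_restrict hΩb
  ⟨memLp_const c, 0, isWeakGrad_const c⟩

theorem wgrad_const (hΩ : IsOpen Ω) (hΩb : Bornology.IsBounded Ω) (c : ℝ) :
    ∀ᵐ x ∂(volume.restrict Ω), wgrad Ω (fun _ => c) x = 0 :=
  (isH1_const hΩb c).isWeakGrad.ae_eq hΩ hΩb (isWeakGrad_const c)

/-- `H¹(Ω)` is stable under composition with functions of bounded continuous derivative. -/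
theorem IsH1.comp (hΩ : IsOpen Ω) (hΩb : Bornology.IsBounded Ω) {f : Space d → ℝ}
    (hf : IsH1 Ω f) {K K' : ℝ → ℝ} (hK : ∀ t, HasDerivAt K (K' t) t) (hK' : Continuous K')
    {M : ℝ} (hM : ∀ t, |K' t| ≤ M) :
    IsH1 Ω (fun x => K (f x)) ∧
      ∀ᵐ x ∂(volume.restrict Ω), wgrad Ω (fun x => K (f x)) x = K' (f x) • wgrad Ω f x := by
  have := isFiniteMeasure_restrict hΩb
  have hw := hf.isWeakGrad.comp hΩ (hf.1.integrableOn hΩb) (hf.isWeakGrad.1.integrableOn hΩb)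
    hK hK' hM
  have hKc : Continuous K := continuous_iff_continuousAt.2 fun t => (hK t).continuousAt
  have hL2 : IsL2 Ω (fun x => K (f x)) := by
    have h1 : MemLp (fun x => K (f x) - K 0) 2 (volume.restrict Ω) := by
      refine MemLp.of_le_mul (c := M) hf.1
        ((hKc.comp_aestronglyMeasurable hf.1.1).sub aestronglyMeasurable_const)
        (Eventually.of_forall fun x => ?_)
      simpa using convex_univ.norm_image_sub_le_of_norm_hasDerivWithin_le (f := K) (f' := K')
        (C := M) (fun x _ => (hK x).hasDerivWithinAt) (fun x _ => hM x) (Set.mem_univ 0)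
        (Set.mem_univ (f x))
    have h2 := h1.add (memLp_const (K 0))
    exact h2.ae_eq (Eventually.of_forall fun x => by simp)
  have hH1 : IsH1 Ω (fun x => K (f x)) := ⟨hL2, _, hw⟩
  exact ⟨hH1, hH1.isWeakGrad.ae_eq hΩ hΩb hw⟩

theorem IsVecH1.isL2 {v : Space d → Space d} (hv : IsVecH1 Ω v) : IsL2 Ω v :=
  memLp_piLp_iff.2 fun i => (hv i).1

end Sobolev

/-! ### The cutoff family and its scaling in `ε`. -/

section Cutoff

/-- Freezing a function at `0` creates no corner when its derivative vanishes there. This keeps the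
truncated functions within reach of the `C¹` chain rule. -/
theorem hasDerivAt_comp_min {k k' : ℝ → ℝ} (hk : ∀ t, HasDerivAt k (k' t) t) (h0 : k' 0 = 0)
    (t : ℝ) : HasDerivAt (fun s => k (min s 0)) (k' (min t 0)) t := by
  rcases lt_trichotomy t 0 with ht | rfl | ht
  · rw [min_eq_left ht.le]
    refine (hk t).congr_of_eventuallyEq ?_
    filter_upwards [gt_mem_nhds ht] with s hs
    rw [min_eq_left hs.le]
  · have h := hk 0
    rw [h0] at h
    rw [min_self, h0]
    rw [hasDerivAt_iff_isLittleO] at h ⊢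
    simp only [min_self, smul_zero, sub_zero] at h ⊢
    refine Asymptotics.IsLittleO.of_bound fun c hc => ?_
    filter_upwards [h.def hc] with s hs
    rcases le_total s 0 with h1 | h1
    · rwa [min_eq_left h1]
    · rw [min_eq_right h1, sub_self, norm_zero]
      positivity
  · rw [min_eq_right ht.le, h0]
    refine (hasDerivAt_const t (k 0)).congr_of_eventuallyEq ?_
    filter_upwards [lt_mem_nhds ht] with s hs
    rw [min_eq_right hs.le]

variable (ε : ℝ)

/-- A smooth approximation of the indicator function of the negative half-line. -/
noncomputable def cutoff (t : ℝ) : ℝ := (min t 0 / ε) ^ 2 / (1 + (min t 0 / ε) ^ 2)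

/-- The derivative of `cutoff`. -/
noncomputable def cutoffDeriv (t : ℝ) : ℝ :=
  2 * (min t 0 / ε) / (1 + (min t 0 / ε) ^ 2) ^ 2 / ε

/-- A primitive of `cutoff`. -/
noncomputable def cutoffPrimitive (t : ℝ) : ℝ :=
  ε * (min t 0 / ε - Real.arctan (min t 0 / ε))

/-- A primitive of `t ↦ t * cutoffDeriv ε t`. -/
noncomputable def cutoffRemainder (t : ℝ) : ℝ :=
  ε * (Real.arctan (min t 0 / ε) - min t 0 / ε / (1 + (min t 0 / ε) ^ 2))

variable {ε}

theorem hasDerivAt_comp_min_div {k k' : ℝ → ℝ} (hk : ∀ t, HasDerivAt k (k' t) t)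
    (h0 : k' 0 = 0) (t : ℝ) :
    HasDerivAt (fun s => k (min s 0 / ε)) (k' (min t 0 / ε) / ε) t := by
  refine hasDerivAt_comp_min (k := fun s => k (s / ε)) (k' := fun s => k' (s / ε) / ε)
    (fun s => ?_) (by simp [h0]) t
  have h := (hk (s / ε)).comp s ((hasDerivAt_id s).div_const ε)
  simpa [Function.comp_def, div_eq_mul_inv] using h

theorem hasDerivAt_cutoff (t : ℝ) : HasDerivAt (cutoff ε) (cutoffDeriv ε t) t := by
  refine hasDerivAt_comp_min_div (k := fun s => s ^ 2 / (1 + s ^ 2))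
    (k' := fun s => 2 * s / (1 + s ^ 2) ^ 2) (fun s => ?_) (by simp) t
  have h := (hasDerivAt_pow 2 s).div ((hasDerivAt_pow 2 s).const_add 1)
    (by positivity : (1 : ℝ) + s ^ 2 ≠ 0)
  refine h.congr_deriv ?_
  have : (1 : ℝ) + s ^ 2 ≠ 0 := by positivity
  field_simp
  ring

theorem hasDerivAt_cutoffPrimitive (hε : 0 < ε) (t : ℝ) :
    HasDerivAt (cutoffPrimitive ε) (cutoff ε t) t := by
  have h := (hasDerivAt_comp_min_div (ε := ε) (k := fun s => s - Real.arctan s)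
    (k' := fun s => s ^ 2 / (1 + s ^ 2)) (fun s => ?_) (by simp) t).const_mul ε
  · refine h.congr_deriv ?_
    rw [mul_div_cancel₀ _ hε.ne', cutoff]
  · refine ((hasDerivAt_id s).sub (Real.hasDerivAt_arctan s)).congr_deriv ?_
    have : (1 : ℝ) + s ^ 2 ≠ 0 := by positivity
    field_simp
    ring

theorem hasDerivAt_cutoffRemainder (hε : 0 < ε) (t : ℝ) :
    HasDerivAt (cutoffRemainder ε) (t * cutoffDeriv ε t) t := by
  have h := (hasDerivAt_comp_min_div (ε := ε) (k := fun s => Real.arctan s - s / (1 + s ^ 2))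
    (k' := fun s => 2 * s ^ 2 / (1 + s ^ 2) ^ 2) (fun s => ?_) (by simp) t).const_mul ε
  · refine h.congr_deriv ?_
    rw [mul_div_cancel₀ _ hε.ne', cutoffDeriv]
    rcases le_total t 0 with ht | ht
    · rw [min_eq_left ht]
      ring
    · simp [min_eq_right ht]
  · have h1 := (hasDerivAt_id s).div ((hasDerivAt_pow 2 s).const_add 1)
      (by positivity : (1 : ℝ) + s ^ 2 ≠ 0)
    refine ((Real.hasDerivAt_arctan s).sub h1).congr_deriv ?_
    have : (1 : ℝ) + s ^ 2 ≠ 0 := by positivity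
    simp only [id]
    field_simp
    ring

theorem continuous_cutoffDeriv : Continuous (cutoffDeriv ε) := by
  unfold cutoffDeriv
  refine Continuous.div_const (Continuous.div (by fun_prop) (by fun_prop) fun t => ?_) _
  positivity

theorem abs_cutoffDeriv_le (hε : 0 < ε) (t : ℝ) : |cutoffDeriv ε t| ≤ 1 / ε := by
  unfold cutoffDeriv
  set s := min t 0 / ε
  rw [abs_div, abs_of_pos hε]
  gcongr
  rw [abs_div, abs_of_pos (by positivity : (0 : ℝ) < (1 + s ^ 2) ^ 2), div_le_one (by positivity),
    abs_le]
  constructor <;> nlinarith [sq_nonneg (s - 1), sq_nonneg (s + 1), sq_nonneg s, sq_nonneg (s ^ 2)]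

theorem cutoffDeriv_nonpos (hε : 0 < ε) (t : ℝ) : cutoffDeriv ε t ≤ 0 := by
  unfold cutoffDeriv
  have : min t 0 / ε ≤ 0 := div_nonpos_of_nonpos_of_nonneg (min_le_right _ _) hε.le
  exact div_nonpos_of_nonpos_of_nonneg
    (div_nonpos_of_nonpos_of_nonneg (by linarith) (by positivity)) hε.le

theorem cutoff_nonneg (t : ℝ) : 0 ≤ cutoff ε t := by
  unfold cutoff
  positivity

theorem cutoff_le_one (t : ℝ) : cutoff ε t ≤ 1 := by
  unfold cutoff
  rw [div_le_one (by positivity)]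
  linarith

theorem continuous_cutoff : Continuous (cutoff ε) :=
  continuous_iff_continuousAt.2 fun t => (hasDerivAt_cutoff t).continuousAt

/-- The product depends on `t / ε` alone. The bound is what places `cutoffRemainder ε ∘ c` in
`H¹(Ω)`. -/
theorem abs_mul_cutoffDeriv_le (t : ℝ) : |t * cutoffDeriv ε t| ≤ 1 := by
  rcases le_total t 0 with ht | ht
  · have e : t * cutoffDeriv ε t = 2 * (t / ε) ^ 2 / (1 + (t / ε) ^ 2) ^ 2 := by
      rw [cutoffDeriv, min_eq_left ht]
      ring
    rw [e, abs_of_nonneg (by positivity), div_le_one (by positivity)]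
    nlinarith [sq_nonneg ((t / ε) ^ 2)]
  · simp [cutoffDeriv, min_eq_right ht]

/-- The bracket is a bounded function of `s` (`2` from the arctangent, `1` from the quotient). The
remaining factor `ε` makes the drift vanish in the limit, hence no restriction on `τ`. -/
theorem abs_cutoffRemainder_le (hε : 0 < ε) (t : ℝ) : |cutoffRemainder ε t| ≤ 3 * ε := by
  unfold cutoffRemainder
  set s := min t 0 / ε
  rw [abs_mul, abs_of_pos hε, mul_comm]
  refine mul_le_mul_of_nonneg_right ?_ hε.le
  have h1 : |Real.arctan s| ≤ 2 := by
    rw [abs_le]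
    constructor <;>
      linarith [Real.arctan_lt_pi_div_two s, Real.neg_pi_div_two_lt_arctan s, Real.pi_le_four]
  have h2 : |s / (1 + s ^ 2)| ≤ 1 := by
    rw [abs_div, abs_of_pos (by positivity : (0 : ℝ) < 1 + s ^ 2), div_le_one (by positivity),
      abs_le]
    constructor <;> nlinarith [sq_nonneg (s - 1), sq_nonneg (s + 1)]
  have := abs_sub (Real.arctan s) (s / (1 + s ^ 2))
  linarith

/-- For `t ≤ 0` and `s = t / ε` the right side is `-t + ε * (s / (1 + s ^ 2))`, and the quotient is
at least `-1`. -/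
theorem neg_min_sub_le_neg_mul_cutoff (hε : 0 < ε) (t : ℝ) :
    -min t 0 - ε ≤ -t * cutoff ε t := by
  rcases le_total t 0 with ht | ht
  · rw [cutoff, min_eq_left ht]
    set s := t / ε with hs
    have e : t = ε * s := by rw [hs, mul_div_cancel₀ _ hε.ne']
    have h0 : (0 : ℝ) < 1 + s ^ 2 := by positivity
    have e2 : -t * (s ^ 2 / (1 + s ^ 2)) = -t + ε * (s / (1 + s ^ 2)) := by
      rw [e]
      field_simp
      ring
    have h2 : -1 ≤ s / (1 + s ^ 2) := by
      rw [le_div_iff₀ h0]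
      nlinarith [sq_nonneg (s + 1)]
    rw [e2]
    nlinarith
  · simp only [cutoff, min_eq_right ht]
    simp [hε.le]

end Cutoff

/-! ### Mass conservation and positivity for one step. -/

section Scheme

variable {d : ℕ} {Ω : Set (Space d)}

/-- A solenoidal field that is tangential at the boundary is orthogonal to gradients. -/
theorem ZeroNormalTrace.integral_inner_wgrad {v : Space d → Space d} (hv : ZeroNormalTrace Ω v)
    (hdiv : ∀ᵐ x ∂(volume.restrict Ω), divergence Ω v x = 0) {q : Space d → ℝ} (hq : IsH1 Ω q) :
    ∫ x in Ω, inner ℝ (v x) (wgrad Ω q x) = 0 := by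
  have h := hv q hq
  have h0 : ∫ x in Ω, divergence Ω v x * q x = 0 := by
    refine integral_eq_zero_of_ae ?_
    filter_upwards [hdiv] with x hx
    simp [hx]
  rwa [h0, add_zero] at h

theorem ConcentrationEq.integral_eq (hΩ : IsOpen Ω) (hΩb : Bornology.IsBounded Ω) {τ s : ℝ}
    (hτ : 0 < τ) {u : Space d → Space d} {φ c' c : Space d → ℝ}
    (h : ConcentrationEq Ω τ s u φ c' c) (hc' : IsL2 Ω c') (hu : ZeroNormalTrace Ω u)
    (hdiv : ∀ᵐ x ∂(volume.restrict Ω), divergence Ω u x = 0) :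
    ∫ x in Ω, c x = ∫ x in Ω, c' x := by
  obtain ⟨-, -, e⟩ := h.2 _ (isH1_const hΩb 1)
  have hw := wgrad_const hΩ hΩb 1
  have e1 : ∫ x in Ω, inner ℝ (wgrad Ω c x) (wgrad Ω (fun _ => (1 : ℝ)) x) = 0 := by
    refine integral_eq_zero_of_ae ?_
    filter_upwards [hw] with x hx
    simp [hx]
  have e2 : ∫ x in Ω, c x * inner ℝ (wgrad Ω φ x) (wgrad Ω (fun _ => (1 : ℝ)) x) = 0 := by
    refine integral_eq_zero_of_ae ?_
    filter_upwards [hw] with x hx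
    simp [hx]
  have e3 := hu.integral_inner_wgrad hdiv h.1
  simp only [mul_one] at e
  rw [e1, e2, e3, integral_div, integral_sub (h.1.1.integrableOn hΩb) (hc'.integrableOn hΩb)] at e
  have := hτ.ne'
  field_simp at e
  linarith

theorem ConcentrationEq.integral_neg_mul_cutoff_le (hΩ : IsOpen Ω) (hΩb : Bornology.IsBounded Ω)
    {τ s : ℝ} (hτ : 0 < τ) {u : Space d → Space d} {φ f c' c : Space d → ℝ}
    (h : ConcentrationEq Ω τ s u φ c' c) (hc' : IsL2 Ω c') (hu : ZeroNormalTrace Ω u)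
    (hdiv : ∀ᵐ x ∂(volume.restrict Ω), divergence Ω u x = 0) (hφ : PoissonNeumann Ω φ f)
    (hf : IntegrableOn f Ω) (hpos : ∀ᵐ x ∂(volume.restrict Ω), 0 ≤ c' x) {ε : ℝ} (hε : 0 < ε) :
    ∫ x in Ω, -c x * cutoff ε (c x) ≤ τ * (|s| * ((∫ x in Ω, |f x|) * (3 * ε))) := by
  obtain ⟨hq, hwq⟩ := h.1.comp hΩ hΩb (hasDerivAt_cutoff (ε := ε)) continuous_cutoffDeriv
    (abs_cutoffDeriv_le hε)
  obtain ⟨hG, hwG⟩ := h.1.comp hΩ hΩb (hasDerivAt_cutoffPrimitive hε) continuous_cutoff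
    (M := 1) (fun t => by rw [abs_of_nonneg (cutoff_nonneg t)]; exact cutoff_le_one t)
  obtain ⟨hH, hwH⟩ := h.1.comp hΩ hΩb (hasDerivAt_cutoffRemainder hε)
    (continuous_id.mul continuous_cutoffDeriv) abs_mul_cutoffDeriv_le
  obtain ⟨-, -, e⟩ := h.2 _ hq
  have ic := h.1.1.integrableOn hΩb
  have ic' := hc'.integrableOn hΩb
  have hcut : AEStronglyMeasurable (fun x => cutoff ε (c x)) (volume.restrict Ω) :=
    continuous_cutoff.comp_aestronglyMeasurable ic.aestronglyMeasurable
  have hbd : ∀ x, ‖cutoff ε (c x)‖ ≤ 1 := fun x => by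
    rw [Real.norm_eq_abs, abs_of_nonneg (cutoff_nonneg _)]
    exact cutoff_le_one _
  have i1 : Integrable (fun x => c x * cutoff ε (c x)) (volume.restrict Ω) :=
    Integrable.mul_bdd (c := 1) ic hcut (Eventually.of_forall hbd)
  have i2 : Integrable (fun x => c' x * cutoff ε (c x)) (volume.restrict Ω) :=
    Integrable.mul_bdd (c := 1) ic' hcut (Eventually.of_forall hbd)
  have diffusion : ∫ x in Ω, inner ℝ (wgrad Ω c x) (wgrad Ω (fun x => cutoff ε (c x)) x) ≤ 0 := by
    refine integral_nonpos_of_ae ?_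
    filter_upwards [hwq] with x hx
    rw [hx, inner_smul_right]
    exact mul_nonpos_of_nonpos_of_nonneg (cutoffDeriv_nonpos hε _) real_inner_self_nonneg
  have convection : ∫ x in Ω, inner ℝ (u x) (wgrad Ω c x) * cutoff ε (c x) = 0 := by
    rw [← hu.integral_inner_wgrad hdiv hG]
    refine integral_congr_ae ?_
    filter_upwards [hwG] with x hx
    rw [hx, inner_smul_right, mul_comm]
  -- Since `c * cutoffDeriv ε c * ∇c` is the gradient of `cutoffRemainder ε ∘ c`, the weak Poisson
  -- equation applies and no bound on `∇φ` is needed.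
  have drift : ∫ x in Ω, c x * inner ℝ (wgrad Ω φ x) (wgrad Ω (fun x => cutoff ε (c x)) x) =
      ∫ x in Ω, f x * cutoffRemainder ε (c x) := by
    rw [← hφ.2 _ hH]
    refine integral_congr_ae ?_
    filter_upwards [hwq, hwH] with x hx hx'
    rw [hx, hx', inner_smul_right, inner_smul_right, mul_assoc]
  have hdrift : |∫ x in Ω, f x * cutoffRemainder ε (c x)| ≤ (∫ x in Ω, |f x|) * (3 * ε) := by
    rw [← integral_mul_const, ← Real.norm_eq_abs]
    refine norm_integral_le_of_norm_le (hf.abs.mul_const _) (Eventually.of_forall fun x => ?_)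
    rw [norm_mul, Real.norm_eq_abs, Real.norm_eq_abs]
    exact mul_le_mul_of_nonneg_left (abs_cutoffRemainder_le hε _) (abs_nonneg _)
  have old : 0 ≤ ∫ x in Ω, c' x * cutoff ε (c x) := by
    refine integral_nonneg_of_ae ?_
    filter_upwards [hpos] with x hx
    exact mul_nonneg hx (cutoff_nonneg _)
  have time : ∫ x in Ω, (c x - c' x) / τ * cutoff ε (c x) =
      ((∫ x in Ω, c x * cutoff ε (c x)) - ∫ x in Ω, c' x * cutoff ε (c x)) / τ := by
    rw [← integral_sub i1 i2, ← integral_div]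
    exact integral_congr_ae (Eventually.of_forall fun x => by ring)
  rw [convection, drift, time] at e
  have hs : -(s * ∫ x in Ω, f x * cutoffRemainder ε (c x)) ≥
      -(|s| * ((∫ x in Ω, |f x|) * (3 * ε))) := by
    have h1 := le_abs_self (s * ∫ x in Ω, f x * cutoffRemainder ε (c x))
    rw [abs_mul] at h1
    have h2 := mul_le_mul_of_nonneg_left hdrift (abs_nonneg s)
    linarith
  have hle : -(|s| * ((∫ x in Ω, |f x|) * (3 * ε))) ≤
      ((∫ x in Ω, c x * cutoff ε (c x)) - ∫ x in Ω, c' x * cutoff ε (c x)) / τ := by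
    linarith
  rw [le_div_iff₀ hτ] at hle
  simp only [neg_mul, integral_neg]
  linarith

/-- The concentrations stay non-negative, whatever the size of the time step. -/
theorem ConcentrationEq.nonneg (hΩ : IsOpen Ω) (hΩb : Bornology.IsBounded Ω)
    {τ s : ℝ} (hτ : 0 < τ) {u : Space d → Space d} {φ f c' c : Space d → ℝ}
    (h : ConcentrationEq Ω τ s u φ c' c) (hc' : IsL2 Ω c') (hu : ZeroNormalTrace Ω u)
    (hdiv : ∀ᵐ x ∂(volume.restrict Ω), divergence Ω u x = 0) (hφ : PoissonNeumann Ω φ f)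
    (hf : IntegrableOn f Ω) (hpos : ∀ᵐ x ∂(volume.restrict Ω), 0 ≤ c' x) :
    ∀ᵐ x ∂(volume.restrict Ω), 0 ≤ c x := by
  have := isFiniteMeasure_restrict hΩb
  have ic : Integrable c (volume.restrict Ω) := h.1.1.integrableOn hΩb
  have im : Integrable (fun x => -min (c x) 0) (volume.restrict Ω) :=
    (ic.inf (integrable_zero _ _ _)).neg
  -- The first summand bounds the drift; the volume collects the pointwise loss `ε` of
  -- `neg_min_sub_le_neg_mul_cutoff`.
  set A := τ * (|s| * ((∫ x in Ω, |f x|) * 3)) + (volume.restrict Ω).real Set.univ with hA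
  have hA0 : 0 ≤ A := by
    have : 0 ≤ ∫ x in Ω, |f x| := integral_nonneg fun _ => abs_nonneg _
    have : 0 ≤ (volume.restrict Ω).real Set.univ := measureReal_nonneg
    positivity
  have key {ε : ℝ} (hε : 0 < ε) : ∫ x in Ω, -min (c x) 0 ≤ A * ε := by
    have h1 := h.integral_neg_mul_cutoff_le hΩ hΩb hτ hc' hu hdiv hφ hf hpos hε
    have i1 : Integrable (fun x => -c x * cutoff ε (c x)) (volume.restrict Ω) := by
      refine Integrable.mul_bdd (c := 1) ic.neg
        (continuous_cutoff.comp_aestronglyMeasurable ic.aestronglyMeasurable)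
        (Eventually.of_forall fun x => ?_)
      rw [Real.norm_eq_abs, abs_of_nonneg (cutoff_nonneg _)]
      exact cutoff_le_one _
    have h2 : ∫ x in Ω, (-min (c x) 0 - ε) ≤ ∫ x in Ω, -c x * cutoff ε (c x) :=
      integral_mono (im.sub (integrable_const ε)) i1
        fun x => neg_min_sub_le_neg_mul_cutoff hε (c x)
    rw [integral_sub im (integrable_const ε), integral_const, smul_eq_mul] at h2
    rw [hA]
    linarith
  have hle : ∫ x in Ω, -min (c x) 0 ≤ 0 := by
    refine le_of_forall_pos_le_add fun δ hδ => ?_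
    refine (key (ε := δ / (A + 1)) (by positivity)).trans ?_
    rw [zero_add, mul_div_assoc', div_le_iff₀ (by positivity)]
    nlinarith
  have h0 : ∀ x, 0 ≤ -min (c x) 0 := fun x => neg_nonneg.2 (min_le_right _ _)
  have hz := (integral_eq_zero_iff_of_nonneg h0 im).1 (le_antisymm hle (integral_nonneg h0))
  filter_upwards [hz] with x hx
  have : min (c x) 0 = 0 := by simpa using hx
  exact min_eq_right_iff.1 this

/-! ### The energy law. -/

theorem gradInner_self (v : Space d → Space d) : gradInner Ω v v = gradNormSq Ω v := by
  simp only [gradInner, gradNormSq, normSq, real_inner_self_eq_norm_sq]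

theorem IsStep.energy_sub_le {τ C₀ : ℝ} (hτ : 0 < τ) {c₁ c₂ φ : Space d → ℝ}
    {u : Space d → Space d} {p : Space d → ℝ} {r : ℝ} {c₁' c₂' φ' : Space d → ℝ}
    {ubar' u' : Space d → Space d} {p' : Space d → ℝ} {r' : ℝ}
    (hu : IsL2 Ω u) (hp : IsH1 Ω p)
    (h : IsStep Ω τ C₀ c₁ c₂ φ u p r c₁' c₂' φ' ubar' u' p' r') :
    energy Ω τ u' p' r' - energy Ω τ u p r ≤
      - τ * gradNormSq Ω ubar' - τ * (normSq Ω (fun x => c₁' x - c₂' x)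
          + ∫ x in Ω, (c₁' x + c₂' x) * ‖wgrad Ω φ' x‖ ^ 2) := by
  obtain ⟨hw10, hmom⟩ := h.momentum
  obtain ⟨-, -, mom⟩ := hmom ubar' hw10
  have hw : IsL2 Ω ubar' := IsVecH1.isL2 fun i => (hw10 i).1
  have hu' : IsL2 Ω u' := h.velocity.isL2
  have hgp : IsL2 Ω (wgrad Ω p) := hp.isWeakGrad.1
  have hgp' : IsL2 Ω (wgrad Ω p') := h.pressure.isWeakGrad.1
  have hd : IsL2 Ω (fun x => ubar' x - u x) := hw.sub hu
  have time : ∫ x in Ω, inner ℝ ((1 / τ) • (ubar' x - u x)) (ubar' x) =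
      1 / (2 * τ) * (normSq Ω ubar' - normSq Ω u + normSq Ω (fun x => ubar' x - u x)) := by
    unfold normSq
    rw [← integral_sub hw.integrableOn_norm_sq hu.integrableOn_norm_sq,
      ← integral_add (by exact hw.integrableOn_norm_sq.sub hu.integrableOn_norm_sq)
        hd.integrableOn_norm_sq, ← integral_const_mul]
    refine integral_congr_ae (Eventually.of_forall fun x => ?_)
    simp only [real_inner_smul_left, inner_sub_left, real_inner_self_eq_norm_sq,
      norm_sub_sq_real, real_inner_comm (ubar' x) (u x)]
    field_simp
    ring
  -- Squaring `u' + τ∇p' = ū + τ∇p`: the cross term on the left vanishes because `u'` is orthogonal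
  -- to gradients.
  have proj : normSq Ω u' + τ ^ 2 * normSq Ω (wgrad Ω p') =
      normSq Ω ubar' + 2 * τ * (∫ x in Ω, inner ℝ (wgrad Ω p x) (ubar' x))
        + τ ^ 2 * normSq Ω (wgrad Ω p) := by
    have h0 : ∫ x in Ω, inner ℝ (u' x) (wgrad Ω p' x) = 0 :=
      h.normal.integral_inner_wgrad h.div_free h.pressure
    have e : ∫ x in Ω, (‖u' x‖ ^ 2 + 2 * τ * inner ℝ (u' x) (wgrad Ω p' x)
          + τ ^ 2 * ‖wgrad Ω p' x‖ ^ 2) =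
        ∫ x in Ω, (‖ubar' x‖ ^ 2 + 2 * τ * inner ℝ (wgrad Ω p x) (ubar' x)
          + τ ^ 2 * ‖wgrad Ω p x‖ ^ 2) := by
      refine integral_congr_ae ?_
      filter_upwards [h.projection] with x hx
      have hx' : u' x + τ • wgrad Ω p' x = ubar' x + τ • wgrad Ω p x := by
        have h1 := congrArg (fun z => τ • z) hx
        simp only [smul_sub, smul_add, smul_smul, mul_one_div_cancel hτ.ne', one_smul,
          smul_zero] at h1
        rw [← sub_eq_zero, ← h1]
        abel
      have h2 := congrArg (fun z => ‖z‖ ^ 2) hx'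
      simp only [norm_add_sq_real, inner_smul_right, norm_smul, mul_pow, Real.norm_eq_abs,
        sq_abs] at h2
      rw [real_inner_comm (ubar' x) (wgrad Ω p x)]
      linarith
    rw [integral_add (by
        exact hu'.integrableOn_norm_sq.add ((hu'.integrableOn_inner hgp').const_mul _))
        (hgp'.integrableOn_norm_sq.const_mul _),
      integral_add hu'.integrableOn_norm_sq ((hu'.integrableOn_inner hgp').const_mul _),
      integral_add (by
        exact hw.integrableOn_norm_sq.add ((hgp.integrableOn_inner hw).const_mul _))
        (hgp.integrableOn_norm_sq.const_mul _),
      integral_add hw.integrableOn_norm_sq ((hgp.integrableOn_inner hw).const_mul _)] at e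
    simp only [integral_const_mul, h0, mul_zero, add_zero] at e
    exact e
  have hdn : 0 ≤ normSq Ω (fun x => ubar' x - u x) :=
    integral_nonneg fun x => sq_nonneg _
  have aux := h.auxiliary
  rw [time, gradInner_self] at mom
  set B := (∫ x in Ω, inner ℝ (convect Ω u u x) (ubar' x))
    + ∫ x in Ω, inner ℝ (force Ω c₁ c₂ φ x) (ubar' x)
  set D := normSq Ω (fun x => c₁' x - c₂' x)
    + ∫ x in Ω, (c₁' x + c₂' x) * ‖wgrad Ω φ' x‖ ^ 2
  set P := ∫ x in Ω, inner ℝ (wgrad Ω p x) (ubar' x)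
  set E := √(potentialEnergy Ω C₀ φ')
  have aux' : 2 * r' * (r' - r) = τ * (r' / E * B) - τ * D := by
    have h1 : 2 * r' * (r' - r) = 2 * r' * τ * ((r' - r) / τ) := by
      field_simp
    have h2 : 2 * r' * (1 / (2 * r')) = 1 := by
      field_simp [h.aux_ne_zero]
    rw [h1, aux]
    have h3 : 1 / (2 * E) = 1 / 2 * (1 / E) := by
      rw [one_div, mul_inv, one_div, one_div]
    rw [h3]
    linear_combination (-τ * D) * h2
  have mom' : 1 / 2 * (normSq Ω ubar' - normSq Ω u + normSq Ω (fun x => ubar' x - u x))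
      + τ * gradNormSq Ω ubar' + τ * P + τ * (r' / E * B) = 0 := by
    have h1 := congrArg (fun z => τ * z) mom
    simp only [mul_zero] at h1
    rw [← h1]
    field_simp
  unfold energy
  rw [sq_abs, sq_abs]
  -- Half of `proj` with `mom'` and `aux'` cancels `P` and `B`; the discarded terms are half the
  -- squared norm of `ū - u` and `(r' - r) ^ 2`.
  nlinarith [sq_nonneg (r' - r)]

/-- Positivity enters the energy law only here: `√` is `0` at negative arguments. -/
theorem normSq_sqrt_smul {c : Space d → ℝ} (hc : ∀ᵐ x ∂(volume.restrict Ω), 0 ≤ c x)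
    (v : Space d → Space d) :
    normSq Ω (fun x => √(c x) • v x) = ∫ x in Ω, c x * ‖v x‖ ^ 2 := by
  refine integral_congr_ae ?_
  filter_upwards [hc] with x hx
  rw [norm_smul, mul_pow, Real.norm_eq_abs, sq_abs, Real.sq_sqrt hx]

/-- Lets every step be treated like the first, which drives the induction on `n`. -/
theorem IsStep.isInitial {τ C₀ : ℝ} {c₁ c₂ φ : Space d → ℝ} {u : Space d → Space d}
    {p : Space d → ℝ} {r : ℝ} {c₁' c₂' φ' : Space d → ℝ} {ubar' u' : Space d → Space d}
    {p' : Space d → ℝ} {r' : ℝ}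
    (h : IsStep Ω τ C₀ c₁ c₂ φ u p r c₁' c₂' φ' ubar' u' p' r') :
    IsInitial Ω c₁' c₂' φ' u' p' :=
  ⟨h.conc₁.1.1, h.conc₂.1.1, h.potential, h.velocity, h.div_free, h.normal, h.pressure⟩

theorem IsSchemeSolution.isInitial {τ C₀ : ℝ} {N : ℕ} {c₁ c₂ φ : ℕ → Space d → ℝ}
    {ubar u : ℕ → Space d → Space d} {p : ℕ → Space d → ℝ} {r : ℕ → ℝ}
    (h : IsSchemeSolution Ω τ C₀ N c₁ c₂ φ ubar u p r) :
    ∀ n ≤ N, IsInitial Ω (c₁ n) (c₂ n) (φ n) (u n) (p n)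
  | 0, _ => h.initial
  | n + 1, hn => (h.step n hn).isInitial

theorem IsSchemeSolution.nonneg (hΩ : IsOpen Ω) (hΩb : Bornology.IsBounded Ω) {τ C₀ : ℝ}
    (hτ : 0 < τ) {N : ℕ} {c₁ c₂ φ : ℕ → Space d → ℝ}
    {ubar u : ℕ → Space d → Space d} {p : ℕ → Space d → ℝ} {r : ℕ → ℝ}
    (h : IsSchemeSolution Ω τ C₀ N c₁ c₂ φ ubar u p r)
    (hc₁ : ∀ᵐ x ∂(volume.restrict Ω), 0 ≤ c₁ 0 x)
    (hc₂ : ∀ᵐ x ∂(volume.restrict Ω), 0 ≤ c₂ 0 x) :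
    ∀ n ≤ N, (∀ᵐ x ∂(volume.restrict Ω), 0 ≤ c₁ n x) ∧
      (∀ᵐ x ∂(volume.restrict Ω), 0 ≤ c₂ n x) := by
  intro n
  induction n with
  | zero => exact fun _ => ⟨hc₁, hc₂⟩
  | succ n ih =>
    intro hn
    obtain ⟨h1, h2⟩ := ih (Nat.le_of_succ_le hn)
    have hi := h.isInitial n (Nat.le_of_succ_le hn)
    have hs := h.step n hn
    have hf := (hi.conc₁.integrableOn hΩb).sub (hi.conc₂.integrableOn hΩb)
    exact ⟨hs.conc₁.nonneg hΩ hΩb hτ hi.conc₁ hi.normal hi.div_free hi.potential hf h1,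
      hs.conc₂.nonneg hΩ hΩb hτ hi.conc₂ hi.normal hi.div_free hi.potential hf h2⟩

end Scheme

end SAVScheme

theorem theorem2p1 {d : ℕ} (hd : d = 2 ∨ d = 3) (Ω : Set (SAVScheme.Space d)) (hΩ : IsOpen Ω)
    (hΩb : Bornology.IsBounded Ω) (τ C₀ : ℝ) (hτ : 0 < τ) (hC₀ : 0 < C₀) (N : ℕ)
    (c₁ c₂ φ : ℕ → SAVScheme.Space d → ℝ)
    (ubar u : ℕ → SAVScheme.Space d → SAVScheme.Space d)
    (p : ℕ → SAVScheme.Space d → ℝ) (r : ℕ → ℝ)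
    (hsol : SAVScheme.IsSchemeSolution Ω τ C₀ N c₁ c₂ φ ubar u p r)
    (hc₁ : ∀ᵐ x ∂(volume.restrict Ω), 0 ≤ c₁ 0 x)
    (hc₂ : ∀ᵐ x ∂(volume.restrict Ω), 0 ≤ c₂ 0 x) :
    ∀ n < N,
      ((∀ᵐ x ∂(volume.restrict Ω), 0 ≤ c₁ (n + 1) x) ∧
        (∀ᵐ x ∂(volume.restrict Ω), 0 ≤ c₂ (n + 1) x)) ∧
      ((∫ x in Ω, c₁ (n + 1) x) = (∫ x in Ω, c₁ n x) ∧
        (∫ x in Ω, c₂ (n + 1) x) = (∫ x in Ω, c₂ n x)) ∧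
      SAVScheme.energy Ω τ (u (n + 1)) (p (n + 1)) (r (n + 1))
          - SAVScheme.energy Ω τ (u n) (p n) (r n) ≤
        - τ * SAVScheme.gradNormSq Ω (ubar (n + 1))
          - τ * SAVScheme.normSq Ω (fun x => c₁ (n + 1) x - c₂ (n + 1) x)
          - τ * SAVScheme.normSq Ω (fun x =>
              √(c₁ (n + 1) x + c₂ (n + 1) x) • SAVScheme.wgrad Ω (φ (n + 1)) x) := by
  intro n hn
  have hi := hsol.isInitial n hn.le
  have hs := hsol.step n hn
  obtain ⟨h1, h2⟩ := hsol.nonneg hΩ hΩb hτ hc₁ hc₂ (n + 1) hn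
  refine ⟨⟨h1, h2⟩, ⟨hs.conc₁.integral_eq hΩ hΩb hτ hi.conc₁ hi.normal hi.div_free,
    hs.conc₂.integral_eq hΩ hΩb hτ hi.conc₂ hi.normal hi.div_free⟩, ?_⟩
  have he := hs.energy_sub_le hτ hi.velocity.isL2 hi.pressure
  have hpos : ∀ᵐ x ∂(volume.restrict Ω), 0 ≤ c₁ (n + 1) x + c₂ (n + 1) x := by
    filter_upwards [h1, h2] with x hx hx'
    exact add_nonneg hx hx'
  rw [SAVScheme.normSq_sqrt_smul hpos]
  linarith
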